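/- Let $\xi_0\in\{2,3,\dots\}\cup\{\omega\}$ and let $1\le p_1<p_2<\cdots<p_{\xi_0}\le\infty$ be exponents indexed by the integers $1\le k<\xi_0$ together with $\xi_0$, where $p_{\xi_0}=\lim_k p_k$ if $\xi_0=\omega$. Let $0<\theta\le 1/4$. Write $\mathbb N=\{1,2,\dots\}$, let $c_{00}(\mathbb N)$ be the space of finitely supported real sequences, with unit vectors $e_j$, and let $p'$ be the conjugate exponent of $p$. For nonzero $f,g\in c_{00}(\mathbb N)$ write $f<g$ if $\max\operatorname{supp} f<\min\operatorname{supp} g$. Every functional below is an element of $c_{00}(\mathbb N)$, acting by $f(x)=\sum_i f(i)x(i)$; some functionals are assigned orders and sizes (possibly several). Define $W_0\subseteq W_1\subseteq\cdots$ inductively. Let $W_0=\{\pm e_j: j\in\mathbb N\}$, with no order or size assigned. Given $W_m$, let $W_{m+1}$ consist of $W_m$ together with the following functionals. (a) Functionals of order $0$: all $f=\theta\sum_{q=1}^d c_qf_q$ with $f_1<\cdots<f_d$ in $W_m$ and $\sum_{q=1}^d|c_q|^{p_{\xi_0}'}\le 1$. If $f=\theta\sum_{q=1}^d(1/n)^{1/p_{\xi_0}'}f_q$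 for some integer $n\ge1$ and such $f_1<\cdots<f_d$ with $d\le n$, then $f$ is assigned size $n$; an order-$0$ functional that is not of this form has no size as an order-$0$ functional. (b) Functionals of order $k$, for each integer $1\le k<\xi_0$: all $f=\theta\sum_{q=1}^d c_qf_q$ with $d\ge1$ and $f_1<\cdots<f_d$ in $W_m$, each $f_q$ of some order strictly smaller than $k$ with an assigned size $s(f_q)$ (as a functional of that order), such that $d\le\min\operatorname{supp} f_1$; $(\max\operatorname{supp} f_{q-1})^2<\min\operatorname{supp} f_q$ and $s(f_q)>\max\operatorname{supp} f_{q-1}$ for $1<q\le d$; and $\sum_{q=1}^d|c_q|^{p_k'}\le1$ (replaced by $\max_q|c_q|\le 1$ if $k=1$ and $p_1=1$). Such an $f$ is assigned the size $\min_q s(f_q)$. Let $W=\bigcup_{m\ge 0} W_m$, and let $X$ be the completion of $c_{00}(\mathbb N)$ under the norm $\|x\|=\sup\{|f(x)|: f\in W\}$. Then the Banach space $X$ is reflexive. -/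

import Mathlib

open Filter Topology
open scoped ENNReal

noncomputable section

namespace SatSpace

/-- Finitely supported real sequences indexed by the positive integers, i.e. `c₀₀(ℕ)`. -/
abbrev C00 : Type := ℕ+ →₀ ℝ

/-- The parameters of the construction: `ξ ∈ [2, ω]` (`⊤` stands for `ω`), exponents
`1 ≤ p 1 < p 2 < ⋯ < p ξ ≤ ∞`, with `p k → p ω` when `ξ = ω`, and `0 < θ ≤ 1/4`.
The values of `p` outside `[1, ξ]` play no role. -/
structure Params where
  ξ : ℕ∞
  two_le_ξ : 2 ≤ ξ
  p : ℕ∞ → ℝ≥0∞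
  one_le_p : ∀ ζ ∈ Set.Icc 1 ξ, 1 ≤ p ζ
  strictMonoOn_p : StrictMonoOn p (Set.Icc 1 ξ)
  tendsto_p : ξ = ⊤ → Tendsto (fun k : ℕ => p k) atTop (𝓝 (p ⊤))
  θ : ℝ
  θ_pos : 0 < θ
  θ_le : θ ≤ 1 / 4

/-- The conjugate exponent `p'` of `p ∈ (1, ∞]` as a real number (so `p' = 1` for `p = ∞`). -/
def dualExp (p : ℝ≥0∞) : ℝ := (ENNReal.conjExponent p).toReal

/-- The coefficients `c` lie in the unit ball of `ℓ_{p'}`: `∑ |c_q|^{p'} ≤ 1`, which is replaced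
by `max |c_q| ≤ 1` when `p = 1`. -/
def InDualBall (p : ℝ≥0∞) {d : ℕ} (c : Fin d → ℝ) : Prop :=
  if p = 1 then ∀ q, |c q| ≤ 1 else ∑ q, |c q| ^ dualExp p ≤ 1

/-- `f_1 < ⋯ < f_d`: nonzero vectors with `max supp f_q < min supp f_r` for `q < r`. -/
def Successive {d : ℕ} (f : Fin d → C00) : Prop :=
  (∀ q, f q ≠ 0) ∧
    ∀ q r, q < r → ∀ i ∈ (f q).support, ∀ j ∈ (f r).support, i < j

/-- `f_1 < ⋯ < f_d` and `d ≤ min supp f_1`. -/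
def Admissible {d : ℕ} (f : Fin d → C00) : Prop :=
  Successive f ∧ ∀ q : Fin d, (q : ℕ) = 0 → ∀ i ∈ (f q).support, d ≤ (i : ℕ)

/-- `(f_q)` with sizes `(s_q)` is very fast growing: `(max supp f_{q-1})² < min supp f_q` and
`s_q > max supp f_{q-1}` for all `q > 1`. -/
def VeryFastGrowing {d : ℕ} (f : Fin d → C00) (s : Fin d → ℕ) : Prop :=
  ∀ q r : Fin d, (q : ℕ) + 1 = r →
    (∀ i ∈ (f q).support, ∀ j ∈ (f r).support, (i : ℕ) ^ 2 < j) ∧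
    (∀ i ∈ (f q).support, (i : ℕ) < s r)

/-- `f = θ ∑ c_q f_q` with `f_1 < ⋯ < f_d` in `A` and `c` in the unit ball of `ℓ_{p_ξ'}`. -/
def OrderZero (P : Params) (A : Set C00) (f : C00) : Prop :=
  ∃ (d : ℕ) (c : Fin d → ℝ) (g : Fin d → C00),
    (∀ q, g q ∈ A) ∧ Successive g ∧ InDualBall (P.p P.ξ) c ∧ f = P.θ • ∑ q, c q • g q

/-- `f = θ ∑ (1/n)^{1/p_ξ'} f_q` with `f_1 < ⋯ < f_d` in `A`, `d ≤ n` and `n ≥ 1`. -/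
def OrderZeroOfSize (P : Params) (A : Set C00) (n : ℕ) (f : C00) : Prop :=
  0 < n ∧ ∃ (d : ℕ) (g : Fin d → C00),
    d ≤ n ∧ (∀ q, g q ∈ A) ∧ Successive g ∧
      f = P.θ • ∑ q, ((1 / n : ℝ) ^ (1 / dualExp (P.p P.ξ))) • g q

/-- `f = θ ∑ c_q f_q` where `(f_q)` is admissible and very fast growing, each `f_q` has order
`< k` and size `t_q` with respect to `R` (`R g j t` reads: `g` has order `j` with size `t`), `c` is
in the unit ball of `ℓ_{p_k'}`, and `s` is the minimum of the `t_q`. -/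
def OrderOfSize (P : Params) (R : C00 → ℕ → ℕ → Prop) (k s : ℕ) (f : C00) : Prop :=
  ∃ (d : ℕ) (c : Fin d → ℝ) (g : Fin d → C00) (t : Fin d → ℕ),
    (∀ q, ∃ j < k, R (g q) j (t q)) ∧ Admissible g ∧ VeryFastGrowing g t ∧
      InDualBall (P.p k) c ∧ IsLeast (Set.range t) s ∧ f = P.θ • ∑ q, c q • g q

/-- `Stage P m f o s`: the functional `f` belongs to `W_m`, with an order recorded in `o` (if any)
and a size recorded in `s` (if any). A functional may carry several orders and sizes. -/
def Stage (P : Params) : ℕ → C00 → Option ℕ → Option ℕ → Prop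
  | 0, f, o, s => o = none ∧ s = none ∧
      ∃ j : ℕ+, f = Finsupp.single j 1 ∨ f = -Finsupp.single j 1
  | m + 1, f, o, s => Stage P m f o s ∨
      (o = some 0 ∧ s = none ∧ OrderZero P {g | ∃ o' s', Stage P m g o' s'} f) ∨
      (∃ n, o = some 0 ∧ s = some n ∧
        OrderZeroOfSize P {g | ∃ o' s', Stage P m g o' s'} n f) ∨
      (∃ k n : ℕ, 1 ≤ k ∧ (k : ℕ∞) < P.ξ ∧ o = some k ∧ s = some n ∧
        OrderOfSize P (fun g j t => Stage P m g (some j) (some t)) k n f)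

/-- The norming set `W = ⋃ₘ W_m`. -/
def normingSet (P : Params) : Set C00 := {f | ∃ m o s, Stage P m f o s}

/-- The action `f(x) = ∑ f_i x_i`, linear in `x`. -/
def act (f : C00) : C00 →ₗ[ℝ] ℝ := Finsupp.linearCombination ℝ (f : ℕ+ → ℝ)

/-- `c₀₀(ℕ)` carrying the norm `‖x‖ = sup {|f(x)| : f ∈ W}`. -/
def NormedC00 (_ : Params) : Type := C00

instance (P : Params) : AddCommGroup (NormedC00 P) := inferInstanceAs (AddCommGroup C00)
instance (P : Params) : Module ℝ (NormedC00 P) := inferInstanceAs (Module ℝ C00)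

/-- The identity, from `c₀₀(ℕ)` with the norm induced by `W` to plain `c₀₀(ℕ)`. -/
def toC00 (P : Params) : NormedC00 P ≃ₗ[ℝ] C00 := LinearEquiv.refl ℝ C00

/-- The norm induced by `W`. -/
instance instNorm (P : Params) : Norm (NormedC00 P) :=
  ⟨fun x => ⨆ f : normingSet P, |act f (toC00 P x)|⟩

lemma norm_def (P : Params) (x : NormedC00 P) :
    ‖x‖ = ⨆ f : normingSet P, |act f (toC00 P x)| := rfl

/-! The norm is well defined: all `f ∈ W` have coordinates bounded by `1`. -/

lemma dualExp_pos (p : ℝ≥0∞) (hp : p ≠ 1) (h1 : 1 ≤ p) : 0 < dualExp p := by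
  have h : ENNReal.conjExponent p = 1 + (p - 1)⁻¹ := rfl
  have hlt : 1 < p := lt_of_le_of_ne h1 (Ne.symm hp)
  have h0 : p - 1 ≠ 0 := (tsub_pos_of_lt hlt).ne'
  refine ENNReal.toReal_pos ?_ ?_
  · rw [h]; simp
  · rw [h]; simp [h0]

lemma InDualBall.abs_le {p : ℝ≥0∞} (hp : 1 ≤ p) {d : ℕ} {c : Fin d → ℝ} (h : InDualBall p c)
    (q : Fin d) : |c q| ≤ 1 := by
  unfold InDualBall at h
  split_ifs at h with h1
  · exact h q
  · have h2 : |c q| ^ dualExp p ≤ 1 :=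
      (Finset.single_le_sum (f := fun q => |c q| ^ dualExp p)
        (fun _ _ => Real.rpow_nonneg (abs_nonneg _) _) (Finset.mem_univ q)).trans h
    by_contra! h3
    exact absurd (Real.one_lt_rpow h3 (dualExp_pos p h1 hp)) (not_lt.2 h2)

lemma Successive.abs_sum_le {d : ℕ} {c : Fin d → ℝ} {g : Fin d → C00} (hg : Successive g)
    (hc : ∀ q, |c q| ≤ 1) (hb : ∀ q i, |g q i| ≤ 1) (P : Params) (i : ℕ+) :
    |(P.θ • ∑ q, c q • g q) i| ≤ 1 := by
  have h0 : |∑ q, c q * g q i| ≤ 1 := by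
    by_cases h : ∃ q, g q i ≠ 0
    · obtain ⟨q, hq⟩ := h
      have hz : ∀ r, r ≠ q → c r * g r i = 0 := by
        intro r hr
        by_contra hne
        have hri : g r i ≠ 0 := fun h => hne (by simp [h])
        rcases lt_or_gt_of_ne hr with h | h
        · exact lt_irrefl i (hg.2 r q h i (by simpa using hri) i (by simpa using hq))
        · exact lt_irrefl i (hg.2 q r h i (by simpa using hq) i (by simpa using hri))
      rw [Finset.sum_eq_single q (fun r _ hr => hz r hr) (by simp), abs_mul]
      exact mul_le_one₀ (hc q) (abs_nonneg _) (hb q i)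
    · push Not at h
      simp [h]
  have hθ := P.θ_pos
  have hθ' := P.θ_le
  rw [Finsupp.smul_apply, Finsupp.finsetSum_apply]
  simp only [Finsupp.smul_apply, smul_eq_mul]
  rw [abs_mul, abs_of_pos hθ]
  nlinarith [abs_nonneg (∑ q, c q * g q i)]

lemma Stage.abs_le (P : Params) (m : ℕ) : ∀ (f : C00) (o s : Option ℕ), Stage P m f o s →
    ∀ i, |f i| ≤ 1 := by
  have hξ : 1 ≤ P.p P.ξ :=
    P.one_le_p _ ⟨le_trans (by norm_num) P.two_le_ξ, le_rfl⟩
  have hξ1 : P.p P.ξ ≠ 1 := by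
    have h1 : (1 : ℕ∞) < P.ξ := lt_of_lt_of_le (by norm_num) P.two_le_ξ
    have := P.strictMonoOn_p ⟨le_rfl, h1.le⟩ ⟨h1.le, le_rfl⟩ h1
    exact ((P.one_le_p 1 ⟨le_rfl, h1.le⟩).trans_lt this).ne'
  induction m with
  | zero =>
    rintro f o s ⟨-, -, j, rfl | rfl⟩ i
    all_goals
      by_cases h : j = i
      · simp [h]
      · simp [h]
  | succ m ih =>
    intro f o s h i
    rcases h with h | ⟨-, -, d, c, g, hA, hg, hc, rfl⟩ |
      ⟨n, -, -, hn, d, g, -, hA, hg, rfl⟩ |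
      ⟨k, n, hk, hkξ, -, -, d, c, g, t, hR, hg, -, hc, -, rfl⟩
    · exact ih f o s h i
    · refine hg.abs_sum_le (fun q => hc.abs_le hξ q) (fun q i => ?_) P i
      obtain ⟨o', s', h⟩ := hA q
      exact ih _ _ _ h i
    · refine hg.abs_sum_le (fun q => ?_) (fun q i => ?_) P i
      · have hn1 : (1 : ℝ) ≤ n := by exact_mod_cast hn
        have h0 : (0 : ℝ) ≤ 1 / n := by positivity
        rw [abs_of_nonneg (Real.rpow_nonneg h0 _)]
        refine Real.rpow_le_one h0 ?_ ?_
        · rw [div_le_one (by linarith)]; exact hn1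
        · exact (one_div_pos.2 (dualExp_pos _ hξ1 hξ)).le
      · obtain ⟨o', s', h⟩ := hA q
        exact ih _ _ _ h i
    · refine hg.1.abs_sum_le (fun q => hc.abs_le ?_ q) (fun q i => ?_) P i
      · exact P.one_le_p _ ⟨by exact_mod_cast hk, hkξ.le⟩
      · obtain ⟨j, -, h⟩ := hR q
        exact ih _ _ _ h i

lemma bddAbove_act (P : Params) (x : C00) :
    BddAbove (Set.range fun f : normingSet P => |act f x|) := by
  refine ⟨∑ i ∈ x.support, |x i|, ?_⟩
  rintro _ ⟨⟨f, m, o, s, hf⟩, rfl⟩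
  simp only [act, Finsupp.linearCombination_apply, Finsupp.sum, smul_eq_mul]
  refine (Finset.abs_sum_le_sum_abs _ _).trans (Finset.sum_le_sum fun i _ => ?_)
  rw [abs_mul]
  exact mul_le_of_le_one_right (abs_nonneg _) (Stage.abs_le P m f o s hf i)

lemma single_mem_normingSet (P : Params) (j : ℕ+) : Finsupp.single j 1 ∈ normingSet P :=
  ⟨0, none, none, rfl, rfl, j, Or.inl rfl⟩

instance (P : Params) : Nonempty (normingSet P) := ⟨⟨_, single_mem_normingSet P 1⟩⟩

lemma abs_act_le_norm (P : Params) (f : normingSet P) (x : NormedC00 P) :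
    |act f (toC00 P x)| ≤ ‖x‖ :=
  le_ciSup (bddAbove_act P (toC00 P x)) f

lemma normedSpaceCore (P : Params) : NormedSpace.Core ℝ (NormedC00 P) where
  norm_nonneg x := Real.iSup_nonneg fun _ => abs_nonneg _
  norm_smul c x := by
    rw [norm_def, norm_def, Real.norm_eq_abs, Real.mul_iSup_of_nonneg (abs_nonneg c)]
    refine iSup_congr fun f => ?_
    rw [map_smul, map_smul, smul_eq_mul, abs_mul]
  norm_triangle x y := by
    refine ciSup_le fun f => ?_
    rw [map_add, map_add]
    exact (abs_add_le _ _).trans (add_le_add (abs_act_le_norm P f x) (abs_act_le_norm P f y))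
  norm_eq_zero_iff x := by
    constructor
    · intro h
      refine (toC00 P).map_eq_zero_iff.1 (Finsupp.ext fun j => ?_)
      have h1 := abs_act_le_norm P ⟨_, single_mem_normingSet P j⟩ x
      rw [h] at h1
      have h2 : act (Finsupp.single j 1) (toC00 P x) = toC00 P x j := by
        simp only [act, Finsupp.linearCombination_apply, Finsupp.sum, smul_eq_mul,
          Finsupp.single_apply, mul_ite, mul_one, mul_zero]
        rw [Finset.sum_ite_eq]
        split_ifs with hj
        · rfl
        · exact (Finsupp.notMem_support_iff.1 hj).symm
      rw [← h2]
      exact abs_nonpos_iff.1 h1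
    · rintro rfl
      simp [norm_def]

instance (P : Params) : NormedAddCommGroup (NormedC00 P) :=
  NormedAddCommGroup.ofCore (normedSpaceCore P)

instance (P : Params) : NormedSpace ℝ (NormedC00 P) :=
  NormedSpace.ofCore (normedSpaceCore P)

/-- The Banach space `X`: the completion of `c₀₀(ℕ)` under the norm induced by `W`. -/
abbrev SpaceX (P : Params) : Type := UniformSpace.Completion (NormedC00 P)

end SatSpace

end

namespace SatSpace

/-! ### The pairing -/

/-! The unit vectors form a basis of `X` that is boundedly complete and shrinking, and James'
argument then gives reflexivity. The norming set is closed under restriction to coordinate sets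
(`Stage.filter`), so all coordinate projections on `c₀₀(ℕ)` are contractions.

Boundedly complete (`exists_norm_truncate_le`): if a bounded formal series had tails of norm above
`δ`, functionals arbitrarily far out would take values at least `δ` on it. Averaging `n` of them
gives order-0 functionals of size `n` with value at least `θδ`. Combining `d` sufficiently spread
ones with equal coefficients gives an order-1 functional. Since `p 1 < ∞`, the sum of the
coefficients is unbounded in `d`, contradicting boundedness of the series.

Shrinking (`exists_abs_apply_tail_le`): it suffices that, for a given `x₀`, some `N` makes the mean
of `x₀` and of the average of any `N` successive blocks in the unit ball have norm at most `3/4`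
(`exists_norm_average_le`). A functional missing `x₀` loses half of the mean. One meeting `x₀` is at
most `1/2` on the average: of order 0, by an upper `ℓ_p` estimate with `p = p_ξ > 1`; of higher
order, because admissibility bounds its number of components by `max supp x₀`.

For `Φ` in the bidual, the series with coefficients `Φ(e_i*)` is bounded, hence converges to some
`x`; shrinkingness identifies `Φ` with `x`. -/

lemma act_apply (f x : C00) : act f x = ∑ i ∈ x.support, x i * f i := by
  simp [act, Finsupp.linearCombination_apply, Finsupp.sum]

lemma act_smul_sum {d : ℕ} (a : ℝ) (c : Fin d → ℝ) (g : Fin d → C00) (x : C00) :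
    act (a • ∑ q, c q • g q) x = a * ∑ q, c q * act (g q) x := by
  simp only [act_apply, Finsupp.smul_apply, Finsupp.finsetSum_apply, smul_eq_mul, Finset.mul_sum]
  rw [Finset.sum_comm]
  refine Finset.sum_congr rfl fun q _ => Finset.sum_congr rfl fun i _ => ?_
  ring

lemma act_eq_zero_of_disjoint {f x : C00} (h : Disjoint f.support x.support) : act f x = 0 := by
  rw [act_apply]
  refine Finset.sum_eq_zero fun i hi => ?_
  have : f i = 0 := by
    by_contra hne
    exact Finset.disjoint_left.1 h (Finsupp.mem_support_iff.2 hne) hi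
  simp [this]

lemma act_filter (E : ℕ+ → Prop) [DecidablePred E] (f x : C00) :
    act (f.filter E) x = act f (x.filter E) := by
  rw [act_apply, act_apply, Finsupp.support_filter, Finset.sum_filter]
  refine Finset.sum_congr rfl fun i _ => ?_
  by_cases h : E i <;> simp [h]

/-! ### Restricting functionals to a set of coordinates -/

lemma InDualBall.comp {p : ℝ≥0∞} {d d' : ℕ} {c : Fin d → ℝ} (h : InDualBall p c)
    {e : Fin d' → Fin d} (he : Function.Injective e) : InDualBall p (c ∘ e) := by
  unfold InDualBall at *
  split_ifs at h ⊢ with h1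
  · exact fun q => h _
  · refine le_trans ?_ h
    have := Finset.sum_le_sum_of_subset_of_nonneg
      (f := fun q => |c q| ^ dualExp p) (Finset.subset_univ (Finset.univ.map ⟨e, he⟩))
      (fun _ _ _ => Real.rpow_nonneg (abs_nonneg _) _)
    simpa [Finset.sum_map] using this

/-- Growth is imposed on neighbours only, but restriction may delete components and make distant
ones adjacent. Supports increase along the sequence, so the condition at the predecessor of `r`
carries over to every earlier index. -/
lemma VeryFastGrowing.of_lt {d : ℕ} {g : Fin d → C00} {t : Fin d → ℕ} (hg : Successive g)
    (h : VeryFastGrowing g t) {q r : Fin d} (hqr : q < r) :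
    (∀ i ∈ (g q).support, ∀ j ∈ (g r).support, (i : ℕ) ^ 2 < j) ∧
      ∀ i ∈ (g q).support, (i : ℕ) < t r := by
  have hlt : (q : ℕ) < r := hqr
  obtain ⟨r', hr'⟩ : ∃ r' : Fin d, (r' : ℕ) + 1 = r := ⟨⟨r - 1, by omega⟩, by simp; omega⟩
  obtain ⟨h1, h2⟩ := h r' r hr'
  rcases (show q ≤ r' from Fin.le_def.2 (by omega)).eq_or_lt with rfl | hq
  · exact ⟨h1, h2⟩
  · obtain ⟨l, hl⟩ := Finsupp.support_nonempty_iff.2 (hg.1 r')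
    have hil : ∀ i ∈ (g q).support, (i : ℕ) < l := fun i hi => hg.2 q r' hq i hi l hl
    exact ⟨fun i hi j hj => (Nat.pow_le_pow_left (hil i hi).le 2).trans_lt (h1 l hl j hj),
      fun i hi => (hil i hi).trans (h2 l hl)⟩

lemma mem_support_of_mem_support_filter {E : ℕ+ → Prop} [DecidablePred E] {f : C00} {i : ℕ+}
    (h : i ∈ (f.filter E).support) : i ∈ f.support := by
  rw [Finsupp.support_filter] at h
  exact (Finset.mem_filter.1 h).1

/-- Components of a functional must be nonzero, so those killed by the restriction are discarded and
the survivors renumbered in increasing order. The renumbering is independent of the coefficients. -/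
lemma exists_reindex_filter {d : ℕ} (g : Fin d → C00) (E : ℕ+ → Prop) [DecidablePred E] :
    ∃ (d' : ℕ) (e : Fin d' → Fin d), d' ≤ d ∧ StrictMono e ∧ (∀ q, (g (e q)).filter E ≠ 0) ∧
      ∀ c : Fin d → ℝ,
        (∑ q, c q • g q).filter E = ∑ q, c (e q) • (g (e q)).filter E := by
  classical
  let Q : Finset (Fin d) := Finset.univ.filter fun q => (g q).filter E ≠ 0
  refine ⟨Q.card, Q.orderEmbOfFin rfl, by simpa using Finset.card_le_univ Q,
    (Q.orderEmbOfFin rfl).strictMono, fun q => ?_, fun c => ?_⟩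
  · exact (Finset.mem_filter.1 (Q.orderEmbOfFin_mem rfl q)).2
  · have h1 : (∑ q, c q • g q).filter E = ∑ q, c q • (g q).filter E := by
      ext i
      by_cases h : E i <;> simp [h, Finsupp.finsetSum_apply]
    have h2 : ∑ q, c q • (g q).filter E = ∑ q ∈ Q, c q • (g q).filter E := by
      refine (Finset.sum_subset (Finset.subset_univ Q) fun q _ hq => ?_).symm
      have : (g q).filter E = 0 := by simpa [Q] using hq
      rw [this, smul_zero]
    have h3 := Finset.sum_map Finset.univ (Q.orderEmbOfFin rfl).toEmbedding
      fun q => c q • (g q).filter E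
    rw [Finset.map_orderEmbOfFin_univ] at h3
    rw [h1, h2, h3]
    rfl

lemma Successive.filter_comp {d d' : ℕ} {g : Fin d → C00} (hg : Successive g) {E : ℕ+ → Prop}
    [DecidablePred E] {e : Fin d' → Fin d} (he : StrictMono e)
    (h0 : ∀ q, (g (e q)).filter E ≠ 0) : Successive fun q => (g (e q)).filter E :=
  ⟨h0, fun _ _ hqr i hi j hj => hg.2 _ _ (he hqr) i (mem_support_of_mem_support_filter hi) j
    (mem_support_of_mem_support_filter hj)⟩

/-- Restricting a functional keeps its order and can only increase its size. -/
lemma Stage.filter (P : Params) (E : ℕ+ → Prop) [DecidablePred E] (m : ℕ) :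
    ∀ (f : C00) (o s : Option ℕ), Stage P m f o s →
      f.filter E = 0 ∨ ∃ s', Option.Rel (· ≤ ·) s s' ∧ Stage P m (f.filter E) o s' := by
  induction m with
  | zero =>
    rintro f o s ⟨rfl, rfl, j, hj⟩
    by_cases h : E j
    · refine Or.inr ⟨none, .none, rfl, rfl, j, ?_⟩
      refine hj.imp ?_ ?_ <;> rintro rfl
      · exact Finsupp.filter_single_of_pos _ h
      · rw [← Finsupp.single_neg]
        exact Finsupp.filter_single_of_pos _ h
    · refine Or.inl ?_
      rcases hj with rfl | rfl
      · exact Finsupp.filter_single_of_neg _ h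
      · rw [← Finsupp.single_neg]
        exact Finsupp.filter_single_of_neg _ h
  | succ m ih =>
    have ih' : ∀ g : C00, (∃ o s, Stage P m g o s) → g.filter E ≠ 0 →
        ∃ o s, Stage P m (g.filter E) o s := by
      rintro g ⟨o, s, h⟩ h0
      obtain ⟨s', -, h'⟩ := (ih g o s h).resolve_left h0
      exact ⟨o, s', h'⟩
    rintro f o s (h | ⟨rfl, rfl, d, c, g, hA, hg, hc, rfl⟩ |
      ⟨n, rfl, rfl, hn, d, g, hd, hA, hg, rfl⟩ |
      ⟨k, n, hk, hkξ, rfl, rfl, d, c, g, t, hR, hg, hv, hc, hs, rfl⟩)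
    · exact (ih f o s h).imp_right fun ⟨s', h1, h2⟩ => ⟨s', h1, Or.inl h2⟩
    · obtain ⟨d', e, -, he, h0, hsum⟩ := exists_reindex_filter g E
      rw [Finsupp.filter_smul, hsum]
      exact Or.inr ⟨none, .none, Or.inr (Or.inl ⟨rfl, rfl, d', c ∘ e, _,
        fun q => ih' _ (hA _) (h0 q), hg.filter_comp he h0, hc.comp he.injective, rfl⟩)⟩
    · obtain ⟨d', e, hd', he, h0, hsum⟩ := exists_reindex_filter g E
      rw [Finsupp.filter_smul, hsum]
      exact Or.inr ⟨some n, .some le_rfl, Or.inr (Or.inr (Or.inl ⟨n, rfl, rfl, hn, d', _,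
        hd'.trans hd, fun q => ih' _ (hA _) (h0 q), hg.filter_comp he h0, rfl⟩))⟩
    · obtain ⟨d', e, hd', he, h0, hsum⟩ := exists_reindex_filter g E
      rw [Finsupp.filter_smul, hsum]
      have key : ∀ q, ∃ t', t (e q) ≤ t' ∧
          ∃ j < k, Stage P m ((g (e q)).filter E) (some j) (some t') := by
        intro q
        obtain ⟨j, hj, h⟩ := hR (e q)
        obtain ⟨s', h1, h2⟩ := (ih _ _ _ h).resolve_left (h0 q)
        cases h1 with
        | some h1 => exact ⟨_, h1, j, hj, h2⟩
      choose t' ht' hR' using key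
      -- With no surviving component there is no minimum to serve as size; this is why the statement
      -- allows the restriction to vanish.
      rcases Nat.eq_zero_or_pos d' with rfl | hpos
      · left
        simp
      have hne : (Set.range t').Nonempty := ⟨_, ⟨0, hpos⟩, rfl⟩
      have hle : n ≤ sInf (Set.range t') := by
        obtain ⟨q, hq⟩ := Nat.sInf_mem hne
        rw [← hq]
        exact (hs.2 ⟨e q, rfl⟩).trans (ht' q)
      refine Or.inr ⟨some (sInf (Set.range t')), .some hle, Or.inr (Or.inr (Or.inr
        ⟨k, _, hk, hkξ, rfl, rfl, d', c ∘ e, _, t', hR', ⟨hg.1.filter_comp he h0, ?_⟩, ?_,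
          hc.comp he.injective, ⟨Nat.sInf_mem hne, fun x hx => Nat.sInf_le hx⟩, rfl⟩))⟩
      · intro q _ i hi
        have hi := mem_support_of_mem_support_filter hi
        have hdpos : 0 < d := hpos.trans_le hd'
        -- The count only drops, while `d` bounds the support of the original first component from
        -- below and hence all later supports.
        refine hd'.trans ?_
        rcases Nat.eq_zero_or_pos (e q : ℕ) with h | h
        · exact hg.2 _ h i hi
        · obtain ⟨l, hl⟩ := Finsupp.support_nonempty_iff.2 (hg.1.1 ⟨0, hdpos⟩)
          exact (hg.2 _ rfl l hl).trans (hg.1.2 ⟨0, hdpos⟩ (e q) h l hl i hi).le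
      · intro q r hqr
        obtain ⟨h1, h2⟩ := hv.of_lt hg.1 (he (show q < r from Fin.lt_def.2 (by omega)))
        exact ⟨fun i hi j hj => h1 i (mem_support_of_mem_support_filter hi) j
          (mem_support_of_mem_support_filter hj),
          fun i hi => (h2 i (mem_support_of_mem_support_filter hi)).trans_le (ht' r)⟩

lemma Stage.mono (P : Params) {m m' : ℕ} (h : m ≤ m') {f : C00} {o s : Option ℕ}
    (hf : Stage P m f o s) : Stage P m' f o s := by
  induction h with
  | refl => exact hf
  | step _ ih => exact Or.inl ih

lemma zero_mem_normingSet (P : Params) : (0 : C00) ∈ normingSet P := by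
  refine ⟨1, some 0, none, Or.inr (Or.inl ⟨rfl, rfl, 0, 0, 0, fun q => q.elim0,
    ⟨fun q => q.elim0, fun q => q.elim0⟩, ?_, by simp⟩)⟩
  unfold InDualBall
  split_ifs <;> simp

lemma filter_mem_normingSet {P : Params} (E : ℕ+ → Prop) [DecidablePred E] {f : C00}
    (hf : f ∈ normingSet P) : f.filter E ∈ normingSet P := by
  obtain ⟨m, o, s, h⟩ := hf
  rcases h.filter P E m f o s with h0 | ⟨s', -, h'⟩
  · rw [h0]
    exact zero_mem_normingSet P
  · exact ⟨m, o, s', h'⟩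

/-- Finitely many members of the norming set lie in a common stage. -/
lemma exists_common_stage {P : Params} {d : ℕ} {g : Fin d → C00}
    (hg : ∀ q, g q ∈ normingSet P) : ∃ m, ∀ q, g q ∈ {g | ∃ o s, Stage P m g o s} := by
  choose m o s h using hg
  exact ⟨Finset.univ.sup m, fun q =>
    ⟨o q, s q, (h q).mono P (Finset.le_sup (f := m) (Finset.mem_univ q))⟩⟩

lemma smul_sum_mem_normingSet {P : Params} {d : ℕ} {c : Fin d → ℝ} {g : Fin d → C00}
    (hg : ∀ q, g q ∈ normingSet P) (hs : Successive g) (hc : InDualBall (P.p P.ξ) c) :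
    P.θ • ∑ q, c q • g q ∈ normingSet P := by
  obtain ⟨m, hm⟩ := exists_common_stage hg
  exact ⟨m + 1, some 0, none, Or.inr (Or.inl ⟨rfl, rfl, d, c, g, hm, hs, hc, rfl⟩)⟩

lemma Successive.neg {d : ℕ} {g : Fin d → C00} (hg : Successive g) :
    Successive fun q => -g q :=
  ⟨fun q => neg_ne_zero.2 (hg.1 q), by simpa using hg.2⟩

lemma Stage.neg (P : Params) (m : ℕ) :
    ∀ (f : C00) (o s : Option ℕ), Stage P m f o s → Stage P m (-f) o s := by
  induction m with
  | zero =>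
    rintro f o s ⟨rfl, rfl, j, rfl | rfl⟩
    · exact ⟨rfl, rfl, j, Or.inr rfl⟩
    · exact ⟨rfl, rfl, j, Or.inl (neg_neg _)⟩
  | succ m ih =>
    have ih' : ∀ g : C00, (∃ o s, Stage P m g o s) → ∃ o s, Stage P m (-g) o s :=
      fun g ⟨o, s, h⟩ => ⟨o, s, ih g o s h⟩
    have hball : ∀ {p : ℝ≥0∞} {d : ℕ} {c : Fin d → ℝ}, InDualBall p c → InDualBall p (-c) := by
      intro p d c hc
      simpa [InDualBall] using hc
    rintro f o s (h | ⟨rfl, rfl, d, c, g, hA, hg, hc, rfl⟩ |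
      ⟨n, rfl, rfl, hn, d, g, hd, hA, hg, rfl⟩ |
      ⟨k, n, hk, hkξ, rfl, rfl, d, c, g, t, hR, hg, hv, hc, hs, rfl⟩)
    · exact Or.inl (ih f o s h)
    · exact Or.inr (Or.inl ⟨rfl, rfl, d, -c, g, hA, hg, hball hc, by simp⟩)
    -- The coefficients of a sized order-0 functional are prescribed, so the sign moves to the
    -- components; in the other cases it goes to the coefficients.
    · exact Or.inr (Or.inr (Or.inl ⟨n, rfl, rfl, hn, d, fun q => -g q, hd,
        fun q => ih' _ (hA q), hg.neg, by simp⟩))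
    · exact Or.inr (Or.inr (Or.inr ⟨k, n, hk, hkξ, rfl, rfl, d, -c, g, t, hR, hg, hv,
        hball hc, hs, by simp⟩))

lemma neg_mem_normingSet {P : Params} {f : C00} (hf : f ∈ normingSet P) :
    -f ∈ normingSet P := by
  obtain ⟨m, o, s, h⟩ := hf
  exact ⟨m, o, s, h.neg P m f o s⟩

/-! ### The norm on finitely supported sequences -/

lemma abs_act_le {P : Params} {f : C00} (hf : f ∈ normingSet P) (x : C00) :
    |act f x| ≤ ‖(toC00 P).symm x‖ := by
  simpa using abs_act_le_norm P ⟨f, hf⟩ ((toC00 P).symm x)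

lemma norm_symm_le {P : Params} {x : C00} {C : ℝ} (h : ∀ f ∈ normingSet P, |act f x| ≤ C) :
    ‖(toC00 P).symm x‖ ≤ C := by
  rw [norm_def]
  exact ciSup_le fun f => by simpa using h f f.2

lemma norm_symm_filter_le (P : Params) (E : ℕ+ → Prop) [DecidablePred E] (x : C00) :
    ‖(toC00 P).symm (x.filter E)‖ ≤ ‖(toC00 P).symm x‖ :=
  norm_symm_le fun f hf => by
    rw [← act_filter]
    exact abs_act_le (filter_mem_normingSet E hf) x

/-! ### Exponents -/

lemma Params.one_lt_ξ (P : Params) : 1 < P.ξ := lt_of_lt_of_le (by norm_num) P.two_le_ξ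

lemma Params.p_one_lt (P : Params) : P.p 1 < P.p P.ξ :=
  P.strictMonoOn_p ⟨le_rfl, P.one_lt_ξ.le⟩ ⟨P.one_lt_ξ.le, le_rfl⟩ P.one_lt_ξ

lemma Params.one_le_p_one (P : Params) : 1 ≤ P.p 1 := P.one_le_p 1 ⟨le_rfl, P.one_lt_ξ.le⟩

lemma Params.one_lt_p_ξ (P : Params) : 1 < P.p P.ξ := P.one_le_p_one.trans_lt P.p_one_lt

lemma one_le_dualExp {p : ℝ≥0∞} (hp : 1 < p) : 1 ≤ dualExp p := by
  have h : ENNReal.conjExponent p = 1 + (p - 1)⁻¹ := rfl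
  have h0 : p - 1 ≠ 0 := (tsub_pos_of_lt hp).ne'
  unfold dualExp
  rw [← ENNReal.toReal_one]
  refine ENNReal.toReal_mono ?_ (by rw [h]; exact le_self_add)
  rw [h]; simp [h0]

lemma one_lt_dualExp {p : ℝ≥0∞} (hp : 1 < p) (hp' : p ≠ ⊤) : 1 < dualExp p := by
  have h : ENNReal.conjExponent p = 1 + (p - 1)⁻¹ := rfl
  have h0 : p - 1 ≠ 0 := (tsub_pos_of_lt hp).ne'
  unfold dualExp
  rw [h, ENNReal.toReal_add (by simp) (by simp [h0])]
  have : 0 < ((p - 1)⁻¹).toReal := ENNReal.toReal_pos (by simp [hp']) (by simp [h0])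
  simpa using this

/-- Indices can be chosen beyond the supports of all vectors selected before. -/
lemma exists_seq_support_le (G : ℕ → C00) (N : ℕ) :
    ∃ n : ℕ → ℕ, (∀ k, N ≤ n k) ∧ ∀ q r, q < r → ∀ i ∈ (G (n q)).support, (i : ℕ) ≤ n r := by
  let b : ℕ → ℕ := fun m => max m ((G m).support.sup fun i => (i : ℕ))
  let n : ℕ → ℕ := fun k => b^[k] N
  have hstep : ∀ k, n (k + 1) = b (n k) := fun k => Function.iterate_succ_apply' b k N
  have hmono : Monotone n := monotone_nat_of_le_succ fun k => by
    rw [hstep]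
    exact le_max_left _ _
  refine ⟨n, fun k => hmono (Nat.zero_le k), fun q r hqr i hi => ?_⟩
  refine le_trans ?_ (hmono (Nat.succ_le_of_lt hqr))
  rw [Nat.succ_eq_add_one, hstep]
  exact (Finset.le_sup (f := fun i : ℕ+ => (i : ℕ)) hi).trans (le_max_right _ _)

/-! ### The unit vector basis is boundedly complete -/

/-- The finitely supported sequence agreeing with `a` on `E` and vanishing off `E`. -/
noncomputable def truncate (a : ℕ+ → ℝ) (E : Finset ℕ+) : C00 := ∑ i ∈ E, Finsupp.single i (a i)

lemma act_single (f : C00) (i : ℕ+) (r : ℝ) : act f (Finsupp.single i r) = r * f i := by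
  simp [act]

lemma act_truncate (f : C00) (a : ℕ+ → ℝ) (E : Finset ℕ+) :
    act f (truncate a E) = ∑ i ∈ E, a i * f i := by
  simp [truncate, act_single]

lemma linearCombination_eq_act (a : ℕ+ → ℝ) (f : C00) :
    Finsupp.linearCombination ℝ a f = act f (truncate a f.support) := by
  rw [act_truncate, Finsupp.linearCombination_apply, Finsupp.sum]
  exact Finset.sum_congr rfl fun i _ => mul_comm _ _

/-- Here the roles are exchanged: the infinite sequence `a` is tested by the finitely supported `f`,
in a form linear in `f`, as needed to evaluate composite functionals on a formal series. -/
lemma linearCombination_filter_eq_act (a : ℕ+ → ℝ) (E : Finset ℕ+) (f : C00) :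
    Finsupp.linearCombination ℝ a (f.filter (· ∈ E)) = act f (truncate a E) := by
  rw [act_truncate, Finsupp.linearCombination_apply, Finsupp.sum, Finsupp.support_filter]
  refine (Finset.sum_congr rfl fun i hi => ?_).trans
    (Finset.sum_subset (fun i hi => (Finset.mem_filter.1 hi).2) fun i hE hi => ?_)
  · rw [Finsupp.filter_apply_pos _ _ (Finset.mem_filter.1 hi).2, smul_eq_mul, mul_comm]
  · have : f i = 0 := by
      by_contra h
      exact hi (Finset.mem_filter.2 ⟨Finsupp.mem_support_iff.2 h, hE⟩)
    rw [this, mul_zero]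

lemma support_smul_sum_smul {d : ℕ} (a : ℝ) (c : Fin d → ℝ) (g : Fin d → C00) {i : ℕ+}
    (hi : i ∈ (a • ∑ q, c q • g q).support) : ∃ q, i ∈ (g q).support := by
  by_contra! h
  refine Finsupp.mem_support_iff.1 hi ?_
  have : ∀ q, g q i = 0 := fun q => Finsupp.notMem_support_iff.1 (h q)
  simp [this]

/-- For `p = 1` the coefficients may all be `1`. For `1 < p < ∞` the choice `c = d^(-1/p')` gives `d
* c = d^(1 - 1/p')`, which is unbounded because `p' > 1`. -/
lemma exists_constant_inDualBall {p : ℝ≥0∞} (hp : 1 ≤ p) (hp' : p ≠ ⊤) (K : ℝ) :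
    ∃ d : ℕ, 0 < d ∧ ∃ c : ℝ, InDualBall p (fun _ : Fin d => c) ∧ K ≤ d * c := by
  rcases hp.eq_or_lt with rfl | hp1
  · obtain ⟨d, hd⟩ := exists_nat_ge K
    exact ⟨d + 1, d.succ_pos, 1, by simp [InDualBall], by push_cast; linarith⟩
  · have hr := one_lt_dualExp hp1 hp'
    set r := dualExp p with hr_def
    have hpos : 0 < 1 - 1 / r := by
      rw [sub_pos, div_lt_one (by linarith)]
      exact hr
    have ht := (tendsto_rpow_atTop hpos).comp (tendsto_natCast_atTop_atTop (R := ℝ))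
    obtain ⟨d, hd, hd0⟩ := ((ht.eventually_ge_atTop K).and (eventually_gt_atTop 0)).exists
    have hd0' : (0 : ℝ) < d := by exact_mod_cast hd0
    refine ⟨d, hd0, (1 / d : ℝ) ^ (1 / r), ?_, ?_⟩
    · rw [InDualBall, if_neg hp1.ne', ← hr_def]
      have : |(1 / d : ℝ) ^ (1 / r)| ^ r = 1 / d := by
        rw [abs_of_nonneg (by positivity), ← Real.rpow_mul (by positivity),
          one_div_mul_cancel (by linarith), Real.rpow_one]
      simp only [this, Finset.sum_const, Finset.card_univ, Fintype.card_fin, nsmul_eq_mul]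
      rw [mul_one_div_cancel hd0'.ne']
    · refine hd.trans_eq ?_
      simp only [Function.comp_apply]
      rw [Real.rpow_sub hd0', Real.rpow_one, Real.div_rpow zero_le_one hd0'.le, Real.one_rpow,
        mul_one_div]

/-- If members of the norming set take values at least `δ` on `a` arbitrarily far out, then so do,
up to the factor `θ`, functionals of order `0` and of any given size. -/
lemma exists_orderZeroOfSize_large {P : Params} {a : ℕ+ → ℝ} {δ : ℝ} (hδ : 0 < δ)
    (h : ∀ N : ℕ, ∃ g ∈ normingSet P, g ≠ 0 ∧ (∀ i ∈ g.support, N < (i : ℕ)) ∧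
      δ ≤ Finsupp.linearCombination ℝ a g) {n : ℕ} (hn : 0 < n) (N : ℕ) :
    ∃ (m : ℕ) (g : C00), Stage P m g (some 0) (some n) ∧ g ≠ 0 ∧
      (∀ i ∈ g.support, N < (i : ℕ)) ∧ P.θ * δ ≤ Finsupp.linearCombination ℝ a g := by
  choose G hW h0 hsupp hval using h
  obtain ⟨k, hk, hlt⟩ := exists_seq_support_le G N
  let g : Fin n → C00 := fun q => G (k q)
  have hg : Successive g := ⟨fun q => h0 _, fun q r hqr i hi j hj => by
    have := hlt q r hqr i hi
    have := hsupp _ j hj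
    exact PNat.coe_lt_coe _ _ |>.1 (by omega)⟩
  obtain ⟨m, hm⟩ := exists_common_stage (g := g) fun q => hW _
  set b : ℝ := (1 / n : ℝ) ^ (1 / dualExp (P.p P.ξ)) with hb
  have hn' : (1 : ℝ) ≤ n := by exact_mod_cast hn
  -- Since `1/p' ≤ 1`, the prescribed coefficients dominate those of the plain average, which
  -- already preserves the lower bound `δ`.
  have hb1 : 1 / n ≤ b := by
    have hle : (1 / n : ℝ) ≤ 1 := by
      rw [div_le_one (by linarith)]
      exact hn'
    have h1 := one_le_dualExp P.one_lt_p_ξ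
    have := Real.rpow_le_rpow_of_exponent_ge (by positivity : (0 : ℝ) < 1 / n) hle
      (show 1 / dualExp (P.p P.ξ) ≤ 1 by rw [div_le_one (by linarith)]; exact h1)
    rwa [Real.rpow_one] at this
  have hval' : P.θ * δ ≤ Finsupp.linearCombination ℝ a (P.θ • ∑ q, b • g q) := by
    simp only [map_smul, map_sum, smul_eq_mul]
    refine mul_le_mul_of_nonneg_left ?_ P.θ_pos.le
    calc δ = ∑ _q : Fin n, 1 / (n : ℝ) * δ := by
          simp only [Finset.sum_const, Finset.card_univ, Fintype.card_fin, nsmul_eq_mul]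
          field_simp
      _ ≤ _ := Finset.sum_le_sum fun q _ =>
          mul_le_mul hb1 (hval _) hδ.le (le_trans (by positivity) hb1)
  refine ⟨m + 1, _, Or.inr (Or.inr (Or.inl
    ⟨n, rfl, rfl, hn, n, g, le_rfl, hm, hg, rfl⟩)), ?_, ?_, hval'⟩
  · intro h
    rw [h, map_zero] at hval'
    nlinarith [P.θ_pos]
  · intro i hi
    obtain ⟨q, hq⟩ := support_smul_sum_smul _ _ _ hi
    exact (hk q).trans_lt (hsupp _ i hq)

/-- Bounded formal series have small tails. -/
theorem exists_norm_truncate_le {P : Params} {a : ℕ+ → ℝ} {C : ℝ}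
    (hC : ∀ E, ‖(toC00 P).symm (truncate a E)‖ ≤ C) {δ : ℝ} (hδ : 0 < δ) :
    ∃ N : ℕ, ∀ E : Finset ℕ+, (∀ i ∈ E, N < (i : ℕ)) →
      ‖(toC00 P).symm (truncate a E)‖ ≤ δ := by
  by_contra! hcon
  have hbound : ∀ f ∈ normingSet P, Finsupp.linearCombination ℝ a f ≤ C := fun f hf => by
    rw [linearCombination_eq_act]
    exact (le_abs_self _).trans ((abs_act_le hf _).trans (hC _))
  have h1 : ∀ N : ℕ, ∃ g ∈ normingSet P, g ≠ 0 ∧ (∀ i ∈ g.support, N < (i : ℕ)) ∧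
      δ ≤ Finsupp.linearCombination ℝ a g := by
    intro N
    obtain ⟨E, hE, hlarge⟩ := hcon N
    obtain ⟨f, hf, hfx⟩ : ∃ f ∈ normingSet P, δ < act f (truncate a E) := by
      by_contra! h
      refine hlarge.not_ge (norm_symm_le fun f hf => abs_le.2 ⟨?_, h f hf⟩)
      have := h _ (neg_mem_normingSet hf)
      rw [act_truncate] at this ⊢
      simp only [Finsupp.neg_apply, mul_neg, Finset.sum_neg_distrib] at this
      linarith
    rw [← linearCombination_filter_eq_act] at hfx
    refine ⟨_, filter_mem_normingSet (· ∈ E) hf, ?_, fun i hi => ?_, hfx.le⟩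
    · intro h
      rw [h, map_zero] at hfx
      linarith
    · rw [Finsupp.support_filter] at hi
      exact hE i (Finset.mem_filter.1 hi).2
  -- `G N` has size `N + 1` and lives beyond `N ^ 2`. Once `N` bounds all earlier supports, both
  -- very-fast-growing conditions hold automatically.
  choose M G hStage h0 hsupp hval using fun N : ℕ =>
    exists_orderZeroOfSize_large hδ h1 N.succ_pos (N ^ 2)
  have hθδ : 0 < P.θ * (P.θ * δ) := mul_pos P.θ_pos (mul_pos P.θ_pos hδ)
  obtain ⟨d, hd, c, hc, hK⟩ := exists_constant_inDualBall P.one_le_p_one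
    (P.p_one_lt.trans_le le_top).ne ((|C| + 1) / (P.θ * (P.θ * δ)))
  -- Starting the selection at `d` secures admissibility.
  obtain ⟨k, hk, hlt⟩ := exists_seq_support_le G d
  let g : Fin d → C00 := fun q => G (k q)
  have hsq : ∀ n : ℕ, n ≤ n ^ 2 := fun n => Nat.le_self_pow (by norm_num) n
  have hg : Successive g := ⟨fun q => h0 _, fun q r hqr i hi j hj => by
    have h2 := hlt q r hqr i hi
    have h3 := hsupp _ j hj
    exact PNat.coe_lt_coe _ _ |>.1 ((h2.trans (hsq _)).trans_lt h3)⟩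
  let t : Fin d → ℕ := fun q => k q + 1
  have hne : (Set.range t).Nonempty := ⟨_, ⟨0, hd⟩, rfl⟩
  have hmem : P.θ • ∑ q, c • g q ∈ normingSet P := by
    refine ⟨Finset.univ.sup (fun q : Fin d => M (k q)) + 1, some 1, some (sInf (Set.range t)),
      Or.inr (Or.inr (Or.inr ⟨1, _, le_rfl, by exact_mod_cast P.one_lt_ξ, rfl, rfl,
      d, fun _ => c, g, t, fun q => ⟨0, zero_lt_one, (hStage (k q)).mono P
        (Finset.le_sup (f := fun q : Fin d => M (k q)) (Finset.mem_univ q))⟩,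
      ⟨hg, fun q _ i hi => ?_⟩, fun q r hqr => ?_, by exact_mod_cast hc,
      ⟨Nat.sInf_mem hne, fun x hx => Nat.sInf_le hx⟩, rfl⟩))⟩
    · exact ((hk q).trans (hsq _)).trans (hsupp _ i hi).le
    · have hle : ∀ i ∈ (g q).support, (i : ℕ) ≤ k r := hlt q r (by omega)
      exact ⟨fun i hi j hj => (Nat.pow_le_pow_left (hle i hi) 2).trans_lt (hsupp _ j hj),
        fun i hi => Nat.lt_succ_of_le (hle i hi)⟩
  have hcpos : 0 < c := by
    have : 0 < (d : ℝ) * c := lt_of_lt_of_le (by positivity) hK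
    exact pos_of_mul_pos_right this (Nat.cast_nonneg d)
  have h2 := hbound _ hmem
  simp only [map_smul, map_sum, smul_eq_mul] at h2
  have h3 : (d : ℝ) * c * (P.θ * δ) ≤ ∑ q, c * Finsupp.linearCombination ℝ a (g q) := by
    calc (d : ℝ) * c * (P.θ * δ) = ∑ _q : Fin d, c * (P.θ * δ) := by
          simp only [Finset.sum_const, Finset.card_univ, Fintype.card_fin, nsmul_eq_mul]
          ring
      _ ≤ _ := Finset.sum_le_sum fun q _ => mul_le_mul_of_nonneg_left (hval _) hcpos.le
  rw [div_le_iff₀ hθδ] at hK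
  have h4 := mul_le_mul_of_nonneg_left h3 P.θ_pos.le
  linarith [le_abs_self C]

/-! ### Averages of far out block vectors -/

/-- The indices `q` such that `x i` is the first of the vectors `x 0, x 1, …` met by `f q`. -/
def firstMeeting {d : ℕ} (f : Fin d → C00) (x : ℕ → C00) (i : ℕ) : Finset (Fin d) :=
  {q | ¬ Disjoint (f q).support (x i).support ∧ ∀ j < i, Disjoint (f q).support (x j).support}

lemma disjoint_firstMeeting {d : ℕ} (f : Fin d → C00) (x : ℕ → C00) {i j : ℕ} (hij : i ≠ j) :
    Disjoint (firstMeeting f x i) (firstMeeting f x j) := by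
  rw [Finset.disjoint_left]
  intro q hi hj
  simp only [firstMeeting, Finset.mem_filter, Finset.mem_univ, true_and] at hi hj
  rcases lt_or_gt_of_ne hij with h | h
  · exact hi.1 (hj.2 i h)
  · exact hj.1 (hi.2 j h)

lemma abs_sum_le_of_subsingleton {ι : Type*} (s : Finset ι) (u : ι → ℝ) {C : ℝ}
    (hC : 0 ≤ C) (hu : ∀ q ∈ s, |u q| ≤ C)
    (h : ∀ q ∈ s, ∀ r ∈ s, u q ≠ 0 → u r ≠ 0 → q = r) : |∑ q ∈ s, u q| ≤ C := by
  by_cases h0 : ∃ q ∈ s, u q ≠ 0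
  · obtain ⟨q, hq, hq0⟩ := h0
    rw [Finset.sum_eq_single_of_mem q hq fun r hr hrq => by
      by_contra hr0
      exact hrq (h r hr q hq hr0 hq0)]
    exact hu q hq
  · push Not at h0
    rw [Finset.sum_eq_zero h0, abs_zero]
    exact hC

/-- At most one term is nonzero: if `q < r` both meet `x i` and `r` has already met some `x j` with
`j < i`, then `f r` has a support point to the left of one of `f q`, contradicting successiveness.
-/
lemma abs_sum_compl_firstMeeting_le {d : ℕ} {f : Fin d → C00} (hf : Successive f) {c : Fin d → ℝ}
    (hc : ∀ q, |c q| ≤ 1) {x : ℕ → C00}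
    (hx : ∀ i j, i < j → ∀ a ∈ (x i).support, ∀ b ∈ (x j).support, a < b) (i : ℕ)
    (hfx : ∀ q, |act (f q) (x i)| ≤ 1) :
    |∑ q ∈ (firstMeeting f x i)ᶜ, c q * act (f q) (x i)| ≤ 1 := by
  have key : ∀ q r, q < r → r ∉ firstMeeting f x i → act (f q) (x i) ≠ 0 →
      act (f r) (x i) ≠ 0 → False := by
    intro q r hqr hr hq0 hr0
    have hq1 := mt act_eq_zero_of_disjoint hq0
    have hr1 := mt act_eq_zero_of_disjoint hr0
    simp only [firstMeeting, Finset.mem_filter, Finset.mem_univ, true_and, not_and,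
      not_forall] at hr
    obtain ⟨j, hj, hrj⟩ := hr hr1
    obtain ⟨a, ha, ha'⟩ := Finset.not_disjoint_iff.1 hq1
    obtain ⟨b, hb, hb'⟩ := Finset.not_disjoint_iff.1 hrj
    exact lt_asymm (hf.2 q r hqr a ha b hb) (hx j i hj b hb' a ha')
  refine abs_sum_le_of_subsingleton _ _ zero_le_one (fun q _ => ?_)
    fun q hq r hr hq0 hr0 => ?_
  · rw [abs_mul]
    exact mul_le_one₀ (hc q) (abs_nonneg _) (hfx q)
  · have hq0 := right_ne_zero_of_mul hq0
    have hr0 := right_ne_zero_of_mul hr0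
    rcases lt_trichotomy q r with h | h | h
    · exact (key q r h (by simpa using hr) hq0 hr0).elim
    · exact h
    · exact (key r q h (by simpa using hq) hr0 hq0).elim

/-- Apart from the functionals for which `x i` is the first block they meet, at most one of the
successive functionals meets `x i`, which costs `θ` per block. -/
lemma abs_act_sum_le {P : Params} {d : ℕ} {f : Fin d → C00} (hf : Successive f)
    (hW : ∀ q, f q ∈ normingSet P) {c : Fin d → ℝ} (hc : ∀ q, |c q| ≤ 1) {x : ℕ → C00}
    (hx : ∀ i j, i < j → ∀ a ∈ (x i).support, ∀ b ∈ (x j).support, a < b)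
    (hnorm : ∀ i, ‖(toC00 P).symm (x i)‖ ≤ 1) (N : ℕ) :
    |act (P.θ • ∑ q, c q • f q) (∑ i ∈ Finset.range N, x i)| ≤
      P.θ * N + ∑ i ∈ Finset.range N,
        |P.θ * ∑ q ∈ firstMeeting f x i, c q * act (f q) (x i)| := by
  have hpt : ∀ i, |act (P.θ • ∑ q, c q • f q) (x i)| ≤
      P.θ + |P.θ * ∑ q ∈ firstMeeting f x i, c q * act (f q) (x i)| := by
    intro i
    rw [act_smul_sum, ← Finset.sum_add_sum_compl (firstMeeting f x i), mul_add, add_comm P.θ]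
    refine (abs_add_le _ _).trans (add_le_add_right ?_ _)
    rw [abs_mul, abs_of_pos P.θ_pos]
    exact mul_le_of_le_one_right P.θ_pos.le (abs_sum_compl_firstMeeting_le hf hc hx i fun q =>
      (abs_act_le (hW q) _).trans (hnorm i))
  rw [map_sum]
  refine (Finset.abs_sum_le_sum_abs _ _).trans
    ((Finset.sum_le_sum fun i _ => hpt i).trans_eq ?_)
  rw [Finset.sum_add_distrib, Finset.sum_const, Finset.card_range, nsmul_eq_mul, mul_comm]

/-- Upper `ℓ_p`-estimate for a single order zero operation. -/
lemma abs_mul_sum_le {P : Params} {d : ℕ} {f : Fin d → C00} (hf : Successive f)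
    (hW : ∀ q, f q ∈ normingSet P) (c : Fin d → ℝ) (J : Finset (Fin d)) {x : C00}
    (hx : ‖(toC00 P).symm x‖ ≤ 1) :
    |P.θ * ∑ q ∈ J, c q * act (f q) x| ≤
      (∑ q ∈ J, |c q| ^ dualExp (P.p P.ξ)) ^ (1 / dualExp (P.p P.ξ)) := by
  set r := dualExp (P.p P.ξ) with hr_def
  have hr : 1 ≤ r := one_le_dualExp P.one_lt_p_ξ
  have hnn : ∀ q, 0 ≤ |c q| ^ r := fun q => Real.rpow_nonneg (abs_nonneg _) _
  have hS : 0 ≤ ∑ q ∈ J, |c q| ^ r := Finset.sum_nonneg fun q _ => hnn q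
  rcases hS.eq_or_lt with h0 | hpos
  · have hz : ∀ q ∈ J, c q = 0 := fun q hq => by
      have := (Finset.sum_eq_zero_iff_of_nonneg fun q _ => hnn q).1 h0.symm q hq
      exact abs_eq_zero.1 ((Real.rpow_eq_zero (abs_nonneg _) (by linarith)).1 this)
    rw [Finset.sum_eq_zero fun q hq => by rw [hz q hq, zero_mul], mul_zero, abs_zero]
    exact Real.rpow_nonneg hS _
  set γ := (∑ q ∈ J, |c q| ^ r) ^ (1 / r) with hγ
  have hγpos : 0 < γ := Real.rpow_pos_of_pos hpos _
  have hγr : γ ^ r = ∑ q ∈ J, |c q| ^ r := by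
    rw [hγ, ← Real.rpow_mul hS, one_div_mul_cancel (by linarith), Real.rpow_one]
  -- Dividing the coefficients on `J` by their `ℓ_{p'}` norm `γ` yields a member of the norming set,
  -- whose value on `x` is at most `1`.
  let c' : Fin d → ℝ := fun q => if q ∈ J then c q / γ else 0
  have hc' : InDualBall (P.p P.ξ) c' := by
    rw [InDualBall, if_neg P.one_lt_p_ξ.ne', ← hr_def]
    have : ∀ q, |c' q| ^ r = if q ∈ J then |c q| ^ r / γ ^ r else 0 := by
      intro q
      by_cases hq : q ∈ J
      · simp only [c', hq, if_true]
        rw [abs_div, abs_of_pos hγpos, Real.div_rpow (abs_nonneg _) hγpos.le]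
      · simp only [c', hq, if_false, abs_zero]
        exact Real.zero_rpow (by linarith)
    simp only [this]
    rw [← Finset.sum_filter, Finset.filter_mem_eq_inter, Finset.univ_inter, ← Finset.sum_div,
      hγr, div_self hpos.ne']
  have h1 := (abs_act_le (smul_sum_mem_normingSet hW hf hc') x).trans hx
  rw [act_smul_sum] at h1
  have h2 : ∑ q, c' q * act (f q) x = (∑ q ∈ J, c q * act (f q) x) / γ := by
    simp only [c', ite_mul, zero_mul]
    rw [← Finset.sum_filter, Finset.filter_mem_eq_inter, Finset.univ_inter, Finset.sum_div]
    exact Finset.sum_congr rfl fun q _ => by ring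
  rwa [h2, mul_div_assoc', abs_div, abs_of_pos hγpos, div_le_one hγpos] at h1

/-- Functionals meeting a fixed vector `x₀` are small on long averages of blocks: order zero ones
by the upper `ℓ_p`-estimate, and the others since they have at most `max supp x₀` components. -/
lemma exists_abs_act_sum_le (P : Params) (x₀ : C00) :
    ∃ N : ℕ, 0 < N ∧ ∀ x : ℕ → C00,
      (∀ i j, i < j → ∀ a ∈ (x i).support, ∀ b ∈ (x j).support, a < b) →
      (∀ i, ‖(toC00 P).symm (x i)‖ ≤ 1) → ∀ f ∈ normingSet P,
      ¬ Disjoint f.support x₀.support →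
        |act f (∑ i ∈ Finset.range N, x i)| ≤ 1 / 2 * N := by
  set r := dualExp (P.p P.ξ) with hr_def
  have hr : 1 ≤ r := one_le_dualExp P.one_lt_p_ξ
  set M : ℕ := x₀.support.sup fun i => (i : ℕ) with hM
  -- The summands serve higher orders (`M ≤ N/4`), order 0 (`4 ^ r ≤ N`) and unit vectors (`1 ≤
  -- N/2`). Only `x₀` enters, so the blocks can be chosen after `N`.
  obtain ⟨N, hN⟩ := exists_nat_ge (4 * (M : ℝ) + (4 : ℝ) ^ r + 2)
  have h4 : (0 : ℝ) < 4 ^ r := Real.rpow_pos_of_pos (by norm_num) _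
  have hM0 : (0 : ℝ) ≤ M := Nat.cast_nonneg M
  have hN0 : (0 : ℝ) < N := by linarith
  refine ⟨N, by exact_mod_cast hN0, fun x hx hnorm f hf hmeet => ?_⟩
  obtain ⟨m, o, s, hst⟩ := hf
  have hθ : P.θ * N ≤ 1 / 4 * N := mul_le_mul_of_nonneg_right P.θ_le hN0.le
  -- The induction only strips the inclusion of one stage in the next; components are controlled by
  -- the norm bounds alone.
  induction m with
  | zero =>
    have hf : f ∈ normingSet P := ⟨_, _, _, hst⟩
    obtain ⟨-, -, j, hj⟩ := hst
    have hsupp : f.support = {j} := by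
      rcases hj with rfl | rfl
      · exact Finsupp.support_single _ one_ne_zero
      · rw [Finsupp.support_neg]
        exact Finsupp.support_single _ one_ne_zero
    have h1 : |∑ i ∈ Finset.range N, act f (x i)| ≤ 1 := by
      refine abs_sum_le_of_subsingleton _ _ zero_le_one
        (fun i _ => (abs_act_le hf _).trans (hnorm i)) fun i _ k _ hi hk => ?_
      have hi := mt act_eq_zero_of_disjoint hi
      have hk := mt act_eq_zero_of_disjoint hk
      rw [hsupp, Finset.disjoint_singleton_left, not_not] at hi hk
      rcases lt_trichotomy i k with h | h | h
      · exact (lt_irrefl _ (hx i k h j hi j hk)).elim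
      · exact h
      · exact (lt_irrefl _ (hx k i h j hk j hi)).elim
    rw [map_sum]
    linarith
  | succ m ih =>
    have hord0 : ∀ (d : ℕ) (c : Fin d → ℝ) (g : Fin d → C00), (∀ q, g q ∈ normingSet P) →
        Successive g → InDualBall (P.p P.ξ) c →
        |act (P.θ • ∑ q, c q • g q) (∑ i ∈ Finset.range N, x i)| ≤ 1 / 2 * N := by
      intro d c g hW hg hc
      refine (abs_act_sum_le hg hW (fun q => hc.abs_le P.one_lt_p_ξ.le q) hx hnorm N).trans ?_
      set γ : ℕ → ℝ := fun i => (∑ q ∈ firstMeeting g x i, |c q| ^ r) ^ (1 / r) with hγ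
      have hS : ∀ i, 0 ≤ ∑ q ∈ firstMeeting g x i, |c q| ^ r := fun i =>
        Finset.sum_nonneg fun q _ => Real.rpow_nonneg (abs_nonneg _) _
      have hγ0 : ∀ i, 0 ≤ γ i := fun i => Real.rpow_nonneg (hS i) _
      have h1 : ∑ i ∈ Finset.range N,
          |P.θ * ∑ q ∈ firstMeeting g x i, c q * act (g q) (x i)| ≤
          ∑ i ∈ Finset.range N, γ i :=
        Finset.sum_le_sum fun i _ => abs_mul_sum_le hg hW c _ (hnorm i)
      have h2 : ∑ i ∈ Finset.range N, γ i ^ r ≤ 1 := by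
        have : ∀ i, γ i ^ r = ∑ q ∈ firstMeeting g x i, |c q| ^ r := fun i => by
          rw [hγ, ← Real.rpow_mul (hS i), one_div_mul_cancel (by linarith), Real.rpow_one]
        simp only [this]
        rw [← Finset.sum_biUnion fun i _ j _ hij => disjoint_firstMeeting g x hij]
        rw [InDualBall, if_neg P.one_lt_p_ξ.ne', ← hr_def] at hc
        exact (Finset.sum_le_sum_of_subset_of_nonneg (Finset.subset_univ _)
          fun q _ _ => Real.rpow_nonneg (abs_nonneg _) _).trans hc
      -- By the power-mean inequality, `∑ γ i ≤ N^(1 - 1/r)`, which is at most `N/4` as soon as `N ≥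
      -- 4 ^ r`.
      have h3 : (∑ i ∈ Finset.range N, γ i) ^ r ≤ (N : ℝ) ^ (r - 1) := by
        have := Real.rpow_sum_le_const_mul_sum_rpow (Finset.range N) γ hr
        simp only [abs_of_nonneg (hγ0 _), Finset.card_range] at this
        exact this.trans (mul_le_of_le_one_right (Real.rpow_nonneg hN0.le _) h2)
      have h5 : ∑ i ∈ Finset.range N, γ i ≤ 1 / 4 * N := by
        by_contra! hlt
        have := Real.rpow_lt_rpow (by positivity) hlt (by linarith : 0 < r)
        rw [Real.mul_rpow (by norm_num) hN0.le, Real.div_rpow (by norm_num) (by norm_num),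
          Real.one_rpow] at this
        rw [Real.rpow_sub_one hN0.ne'] at h3
        have h6 := this.trans_le h3
        rw [one_div_mul_eq_div, div_lt_div_iff_of_pos_left (Real.rpow_pos_of_pos hN0 _) h4 hN0]
          at h6
        linarith
      linarith
    rcases hst with h | ⟨-, -, d, c, g, hA, hg, hc, rfl⟩ |
      ⟨n, -, -, hn, d, g, hd, hA, hg, rfl⟩ |
      ⟨k, n, hk, hkξ, -, -, d, c, g, t, hR, hg, hv, hc, hs, rfl⟩
    · exact ih h
    · exact hord0 d c g (fun q => ⟨m, hA q⟩) hg hc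
    · refine hord0 d (fun _ => _) g (fun q => ⟨m, hA q⟩) hg ?_
      rw [InDualBall, if_neg P.one_lt_p_ξ.ne', ← hr_def]
      have hn' : (0 : ℝ) < n := by exact_mod_cast hn
      have : |(1 / n : ℝ) ^ (1 / r)| ^ r = 1 / n := by
        rw [abs_of_nonneg (by positivity), ← Real.rpow_mul (by positivity),
          one_div_mul_cancel (by linarith), Real.rpow_one]
      simp only [this, Finset.sum_const, Finset.card_univ, Fintype.card_fin, nsmul_eq_mul]
      rw [mul_one_div, div_le_one hn']
      exact_mod_cast hd
    · have hW : ∀ q, g q ∈ normingSet P := fun q => by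
        obtain ⟨j, -, h⟩ := hR q
        exact ⟨m, _, _, h⟩
      have hc1 : ∀ q, |c q| ≤ 1 := fun q =>
        hc.abs_le (P.one_le_p _ ⟨by exact_mod_cast hk, hkξ.le⟩) q
      -- A common support point of the functional and `x₀` is at least `d` by admissibility and at
      -- most `M`.
      have hdM : d ≤ M := by
        obtain ⟨i, hi, hi'⟩ := Finset.not_disjoint_iff.1 hmeet
        refine le_trans ?_ (Finset.le_sup (f := fun i : ℕ+ => (i : ℕ)) hi')
        obtain ⟨q, hq⟩ := support_smul_sum_smul _ _ _ hi
        have hdpos : 0 < d := q.pos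
        rcases Nat.eq_zero_or_pos (q : ℕ) with h | h
        · exact hg.2 _ h i hq
        · obtain ⟨l, hl⟩ := Finsupp.support_nonempty_iff.2 (hg.1.1 ⟨0, hdpos⟩)
          exact (hg.2 _ rfl l hl).trans (hg.1.2 ⟨0, hdpos⟩ q h l hl i hq).le
      refine (abs_act_sum_le hg.1 hW hc1 hx hnorm N).trans ?_
      have h1 : ∑ i ∈ Finset.range N,
          |P.θ * ∑ q ∈ firstMeeting g x i, c q * act (g q) (x i)| ≤
          ∑ i ∈ Finset.range N, ((firstMeeting g x i).card : ℝ) := by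
        refine Finset.sum_le_sum fun i _ => ?_
        rw [abs_mul, abs_of_pos P.θ_pos]
        refine (mul_le_of_le_one_left (abs_nonneg _) (P.θ_le.trans (by norm_num))).trans ?_
        refine (Finset.abs_sum_le_sum_abs _ _).trans ?_
        refine (Finset.sum_le_card_nsmul _ _ 1 fun q _ => ?_).trans_eq (by simp)
        rw [abs_mul]
        exact mul_le_one₀ (hc1 q) (abs_nonneg _) ((abs_act_le (hW q) _).trans (hnorm i))
      have h2 : ∑ i ∈ Finset.range N, ((firstMeeting g x i).card : ℝ) ≤ M := by
        rw [← Nat.cast_sum, Nat.cast_le,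
          ← Finset.card_biUnion fun i _ j _ hij => disjoint_firstMeeting g x hij]
        exact (Finset.card_le_univ _).trans (by simpa using hdM)
      linarith

/-- The mean of `x₀` and of a long average of normalized blocks has norm at most `3/4`. -/
lemma exists_norm_average_le (P : Params) {x₀ : C00} (h0 : ‖(toC00 P).symm x₀‖ ≤ 1) :
    ∃ N : ℕ, 0 < N ∧ ∀ x : ℕ → C00,
      (∀ i j, i < j → ∀ a ∈ (x i).support, ∀ b ∈ (x j).support, a < b) →
      (∀ i, ‖(toC00 P).symm (x i)‖ ≤ 1) →
        ‖(toC00 P).symm ((N : ℝ) • x₀ + ∑ i ∈ Finset.range N, x i)‖ ≤ 3 / 2 * N := by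
  obtain ⟨N, hN, h⟩ := exists_abs_act_sum_le P x₀
  refine ⟨N, hN, fun x hx hnorm => norm_symm_le fun f hf => ?_⟩
  have hN0 : (0 : ℝ) < N := by exact_mod_cast hN
  rw [map_add, map_smul, smul_eq_mul]
  by_cases hd : Disjoint f.support x₀.support
  · rw [act_eq_zero_of_disjoint hd, mul_zero, zero_add, map_sum]
    refine (Finset.abs_sum_le_sum_abs _ _).trans ((Finset.sum_le_card_nsmul _ _ 1 fun i _ =>
      (abs_act_le hf _).trans (hnorm i)).trans ?_)
    simp
    linarith
  · have h1 := h x hx hnorm f hf hd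
    refine (abs_add_le _ _).trans ?_
    rw [abs_mul, abs_of_pos hN0]
    have := mul_le_of_le_one_right hN0.le ((abs_act_le hf x₀).trans h0)
    linarith

/-! ### The unit vector basis is shrinking -/

/-- The canonical embedding of `c₀₀(ℕ)` into `X`. -/
noncomputable def emb (P : Params) : C00 →ₗ[ℝ] SpaceX P :=
  (UniformSpace.Completion.toComplL (𝕜 := ℝ) (E := NormedC00 P)).toLinearMap ∘ₗ
    (toC00 P).symm.toLinearMap

lemma norm_emb (P : Params) (x : C00) : ‖emb P x‖ = ‖(toC00 P).symm x‖ :=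
  UniformSpace.Completion.norm_coe _

lemma denseRange_emb (P : Params) : DenseRange (emb P) := by
  have h : ⇑(emb P) = (fun x : NormedC00 P => (x : SpaceX P)) ∘ (toC00 P).symm := rfl
  rw [h]
  exact UniformSpace.Completion.denseRange_coe.comp (toC00 P).symm.surjective.denseRange
    (UniformSpace.Completion.continuous_coe _)

lemma abs_apply_le_norm_emb (P : Params) (i : ℕ+) (x : C00) : |x i| ≤ ‖emb P x‖ := by
  have h := abs_act_le (single_mem_normingSet P i) x
  rw [norm_emb]
  refine le_trans (le_of_eq ?_) h
  rw [act_apply]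
  by_cases hi : x i = 0
  · rw [hi, Finset.sum_eq_zero, abs_zero]
    intro j _
    by_cases hj : i = j
    · rw [← hj, hi, zero_mul]
    · rw [Finsupp.single_eq_of_ne (Ne.symm hj), mul_zero]
  · rw [Finset.sum_eq_single_of_mem i (Finsupp.mem_support_iff.2 hi), Finsupp.single_eq_same,
      mul_one]
    intro j _ hj
    rw [Finsupp.single_eq_of_ne hj, mul_zero]

lemma norm_emb_filter_le (P : Params) (E : ℕ+ → Prop) [DecidablePred E] (x : C00) :
    ‖emb P (x.filter E)‖ ≤ ‖emb P x‖ := by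
  rw [norm_emb, norm_emb]
  exact norm_symm_filter_le P E x

/-- Every functional has small restriction to the tails of the basis. -/
theorem exists_abs_apply_tail_le {P : Params} (φ : StrongDual ℝ (SpaceX P)) {ε : ℝ} (hε : 0 < ε) :
    ∃ N : ℕ, ∀ x : C00, (∀ i ∈ x.support, N < (i : ℕ)) → |φ (emb P x)| ≤ ε * ‖emb P x‖ := by
  by_contra hcon
  let S : Set ℝ := {C | 0 ≤ C ∧ ∃ N : ℕ, ∀ x : C00, (∀ i ∈ x.support, N < (i : ℕ)) →
    |φ (emb P x)| ≤ C * ‖emb P x‖}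
  -- The infimum `a` of `S` is the limit of the norms of `φ` on the tails; failure of the claim
  -- makes it at least `ε`.
  have hSne : S.Nonempty := ⟨‖φ‖, norm_nonneg _, 0, fun x _ => φ.le_opNorm _⟩
  have hSb : BddBelow S := ⟨0, fun C hC => hC.1⟩
  set a := sInf S with ha
  have hεa : ε ≤ a := by
    refine le_csInf hSne fun C ⟨_, N, hN⟩ => ?_
    by_contra! hC
    exact hcon ⟨N, fun x hx => (hN x hx).trans
      (mul_le_mul_of_nonneg_right hC.le (norm_nonneg _))⟩
  have ha0 : 0 < a := hε.trans_le hεa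
  -- The factors `11/10` and `9/10` work because `11/10 * 3/2 < 2 * 9/10`: on the vector `y` below,
  -- `φ` is at least `9/5 * a * N`, yet the tail bound keeps it under `33/20 * a * N`.
  obtain ⟨C, ⟨hC0, N₀, hC⟩, hCa⟩ := exists_lt_of_csInf_lt hSne
    (show sInf S < 11 / 10 * a by rw [← ha]; linarith)
  have hbig : ∀ N : ℕ, ∃ x : C00, (∀ i ∈ x.support, N < (i : ℕ)) ∧ ‖emb P x‖ ≤ 1 ∧
      9 / 10 * a ≤ φ (emb P x) := by
    intro N
    have hnot : 9 / 10 * a ∉ S := notMem_of_lt_csInf (by rw [← ha]; linarith) hSb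
    have : ∃ x : C00, (∀ i ∈ x.support, N < (i : ℕ)) ∧
        9 / 10 * a * ‖emb P x‖ < φ (emb P x) := by
      by_contra! h
      refine hnot ⟨by positivity, N, fun x hx => abs_le.2 ⟨?_, h x hx⟩⟩
      have := h (-x) (by simpa using hx)
      rw [map_neg, map_neg, norm_neg] at this
      linarith
    obtain ⟨x, hx, hlt⟩ := this
    have hpos : 0 < ‖emb P x‖ := by
      refine norm_pos_iff.2 fun h => ?_
      rw [h, map_zero, norm_zero, mul_zero] at hlt
      exact lt_irrefl _ hlt
    refine ⟨‖emb P x‖⁻¹ • x, fun i hi => hx i (Finsupp.support_smul hi), ?_, ?_⟩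
    · rw [map_smul, norm_smul, norm_inv, norm_norm, inv_mul_cancel₀ hpos.ne']
    · rw [map_smul, map_smul, smul_eq_mul, inv_mul_eq_div, le_div_iff₀ hpos]
      exact hlt.le
  choose G hsupp hnorm hval using hbig
  obtain ⟨n, hn, hlt⟩ := exists_seq_support_le G N₀
  obtain ⟨N, hN, havg⟩ := exists_norm_average_le P (x₀ := G (n 0))
    (by rw [← norm_emb]; exact hnorm _)
  have hN0 : (0 : ℝ) < N := by exact_mod_cast hN
  have h1 := havg (fun i => G (n (i + 1)))
    (fun i j hij p hp q hq => PNat.coe_lt_coe _ _ |>.1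
      ((hlt (i + 1) (j + 1) (by omega) p hp).trans_lt (hsupp _ q hq)))
    (fun i => by rw [← norm_emb]; exact hnorm _)
  rw [← norm_emb] at h1
  set y : C00 := (N : ℝ) • G (n 0) + ∑ i ∈ Finset.range N, G (n (i + 1)) with hy
  have h2 : |φ (emb P y)| ≤ C * ‖emb P y‖ := by
    refine hC y fun i hi => ?_
    by_contra! hle
    have hz : ∀ k, G (n k) i = 0 := fun k => by
      by_contra h
      have := hsupp (n k) i (Finsupp.mem_support_iff.2 h)
      have := hn k
      omega
    refine Finsupp.mem_support_iff.1 hi ?_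
    simp [hy, hz]
  have h3 : 9 / 5 * a * N ≤ φ (emb P y) := by
    rw [hy, map_add, map_add, map_smul, map_smul, smul_eq_mul, map_sum, map_sum]
    have h4 : (N : ℝ) * (9 / 10 * a) ≤ ∑ i ∈ Finset.range N, φ (emb P (G (n (i + 1)))) := by
      have := Finset.card_nsmul_le_sum (Finset.range N)
        (fun i => φ (emb P (G (n (i + 1))))) (9 / 10 * a) fun i _ => hval _
      simpa using this
    have h5 := mul_le_mul_of_nonneg_left (hval (n 0)) hN0.le
    linarith
  have h6 := h3.trans ((le_abs_self _).trans (h2.trans (mul_le_mul_of_nonneg_left h1 hC0)))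
  have h7 : C * (3 / 2 * N) < 11 / 10 * a * (3 / 2 * N) :=
    mul_lt_mul_of_pos_right hCa (by positivity)
  have h8 : 0 < a * N := mul_pos ha0 hN0
  linarith

/-! ### Reflexivity -/

/-- The coordinate functionals of the unit vector basis. -/
noncomputable def coordFunctional (P : Params) (i : ℕ+) : StrongDual ℝ (SpaceX P) :=
  (Finsupp.lapply i : C00 →ₗ[ℝ] ℝ).extendOfNorm (emb P)

lemma coordFunctional_emb (P : Params) (i : ℕ+) (x : C00) :
    coordFunctional P i (emb P x) = x i :=
  LinearMap.extendOfNorm_eq (denseRange_emb P)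
    ⟨1, fun x => by simpa using abs_apply_le_norm_emb P i x⟩ x

lemma norm_le_of_emb {P : Params} (φ : StrongDual ℝ (SpaceX P)) {C : ℝ} (hC : 0 ≤ C)
    (h : ∀ x, |φ (emb P x)| ≤ C * ‖emb P x‖) : ‖φ‖ ≤ C := by
  refine φ.opNorm_le_bound hC fun z => ?_
  refine (denseRange_emb P).induction_on (p := fun z => ‖φ z‖ ≤ C * ‖z‖) z ?_ h
  exact isClosed_le (by fun_prop) (by fun_prop)

/-- The composition of `φ` with the projection onto the coordinates in `E`. -/
noncomputable def restrictFunctional {P : Params} (φ : StrongDual ℝ (SpaceX P)) (E : Finset ℕ+) :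
    StrongDual ℝ (SpaceX P) :=
  ∑ i ∈ E, φ (emb P (Finsupp.single i 1)) • coordFunctional P i

lemma restrictFunctional_emb {P : Params} (φ : StrongDual ℝ (SpaceX P)) (E : Finset ℕ+) (x : C00) :
    restrictFunctional φ E (emb P x) = φ (emb P (x.filter (· ∈ E))) := by
  have h : x.filter (· ∈ E) = ∑ i ∈ E, x i • Finsupp.single i (1 : ℝ) := by
    ext j
    by_cases hj : j ∈ E <;> simp [Finsupp.finsetSum_apply, Finsupp.single_apply, hj]
  rw [h]
  simp only [restrictFunctional, map_sum, map_smul, smul_eq_mul]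
  simp [coordFunctional_emb, mul_comm]

lemma norm_restrictFunctional_le {P : Params} (φ : StrongDual ℝ (SpaceX P)) (E : Finset ℕ+) :
    ‖restrictFunctional φ E‖ ≤ ‖φ‖ := by
  refine norm_le_of_emb _ (norm_nonneg _) fun x => ?_
  rw [restrictFunctional_emb]
  exact (φ.le_opNorm _).trans
    (mul_le_mul_of_nonneg_left (norm_emb_filter_le P _ x) (norm_nonneg _))

/-- The first `n` coordinates. -/
def initialSegment (n : ℕ) : Finset ℕ+ := (Finset.range n).image Nat.succPNat

lemma mem_initialSegment {n : ℕ} {i : ℕ+} : i ∈ initialSegment n ↔ (i : ℕ) ≤ n := by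
  simp only [initialSegment, Finset.mem_image, Finset.mem_range]
  constructor
  · rintro ⟨k, hk, rfl⟩
    exact hk
  · intro h
    have := i.pos
    exact ⟨i.natPred, by rw [PNat.natPred]; omega, PNat.succPNat_natPred i⟩

lemma tendsto_restrictFunctional {P : Params} (φ : StrongDual ℝ (SpaceX P)) :
    Tendsto (fun n => restrictFunctional φ (initialSegment n)) atTop (𝓝 φ) := by
  rw [Metric.tendsto_atTop]
  intro ε hε
  obtain ⟨N, hN⟩ := exists_abs_apply_tail_le φ (half_pos hε)
  refine ⟨N, fun n hn => ?_⟩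
  rw [dist_comm, dist_eq_norm]
  refine (norm_le_of_emb _ (half_pos hε).le fun x => ?_).trans_lt (half_lt_self hε)
  have h : x = x.filter (· ∈ initialSegment n) + x.filter (¬ · ∈ initialSegment n) :=
    (Finsupp.filter_add_filter_not _ _).symm
  have h1 : (φ - restrictFunctional φ (initialSegment n)) (emb P x) =
      φ (emb P (x.filter (¬ · ∈ initialSegment n))) := by
    rw [sub_apply, restrictFunctional_emb]
    nth_rewrite 1 [h]
    rw [map_add, map_add, add_sub_cancel_left]
  rw [h1]
  refine (hN _ fun i hi => ?_).trans
    (mul_le_mul_of_nonneg_left (norm_emb_filter_le P _ x) (half_pos hε).le)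
  rw [Finsupp.support_filter, Finset.mem_filter, mem_initialSegment] at hi
  omega

lemma map_restrictFunctional {P : Params} (Φ : StrongDual ℝ (StrongDual ℝ (SpaceX P)))
    (φ : StrongDual ℝ (SpaceX P)) (E : Finset ℕ+) :
    Φ (restrictFunctional φ E) =
      φ (emb P (truncate (fun i => Φ (coordFunctional P i)) E)) := by
  have h : ∀ (i : ℕ+) (r : ℝ), Finsupp.single i r = r • Finsupp.single i (1 : ℝ) := by simp
  simp only [restrictFunctional, truncate, map_sum, map_smul, smul_eq_mul]
  refine Finset.sum_congr rfl fun i _ => ?_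
  rw [h i (Φ _), map_smul, map_smul, smul_eq_mul, mul_comm]

/-- The unit vector basis is shrinking and boundedly complete, so `X` is reflexive. -/
theorem surjective_inclusionInDoubleDual (P : Params) :
    Function.Surjective (NormedSpace.inclusionInDoubleDual ℝ (SpaceX P)) := by
  intro Φ
  set a : ℕ+ → ℝ := fun i => Φ (coordFunctional P i) with ha
  have hbound : ∀ E, ‖(toC00 P).symm (truncate a E)‖ ≤ ‖Φ‖ := fun E => by
    rw [← norm_emb]
    refine NormedSpace.norm_le_dual_bound ℝ _ Φ.opNorm_nonneg fun φ => ?_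
    -- By duality, testing the truncation against `φ` amounts to evaluating `Φ` at the restriction
    -- of `φ` to `E`, whose norm is at most that of `φ`.
    rw [← map_restrictFunctional]
    exact (Φ.le_opNorm _).trans
      (mul_le_mul_of_nonneg_left (norm_restrictFunctional_le φ E) Φ.opNorm_nonneg)
  have hcauchy : CauchySeq fun n => emb P (truncate a (initialSegment n)) := by
    rw [Metric.cauchySeq_iff']
    intro ε hε
    obtain ⟨N, hN⟩ := exists_norm_truncate_le hbound (half_pos hε)
    refine ⟨N, fun n hn => ?_⟩
    have hsub : initialSegment N ⊆ initialSegment n := fun i hi => by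
      rw [mem_initialSegment] at hi ⊢
      exact hi.trans hn
    have hdiff : truncate a (initialSegment n) - truncate a (initialSegment N) =
        truncate a (initialSegment n \ initialSegment N) :=
      sub_eq_of_eq_add (Finset.sum_sdiff hsub).symm
    rw [dist_eq_norm, ← map_sub, hdiff, norm_emb]
    refine (hN _ fun i hi => ?_).trans_lt (half_lt_self hε)
    rw [Finset.mem_sdiff, mem_initialSegment, mem_initialSegment] at hi
    omega
  obtain ⟨x, hx⟩ := cauchySeq_tendsto_of_complete hcauchy
  refine ⟨x, ContinuousLinearMap.ext fun φ => ?_⟩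
  rw [NormedSpace.dual_def]
  -- The values of `φ` on the truncations tend to `φ x` by continuity, and to `Φ φ` because the
  -- restrictions of `φ` converge to `φ` in norm.
  refine tendsto_nhds_unique ((φ.continuous.tendsto x).comp hx) ?_
  refine ((Φ.continuous.tendsto φ).comp (tendsto_restrictFunctional φ)).congr fun n => ?_
  exact map_restrictFunctional Φ φ _

end SatSpace

/-- The space `X` is reflexive: the canonical isometric embedding into its bidual is onto. -/
theorem mainTheorem4 (P : SatSpace.Params) :
    Function.Surjective (NormedSpace.inclusionInDoubleDual ℝ (SatSpace.SpaceX P)) :=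
  SatSpace.surjective_inclusionInDoubleDual P
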